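/- **Robust Relational Hyperproperty Preservation (RrHP).** *Setting.* Computations are elements of the free monad $M(\alpha)$ with the operations read, write and allocate on typed monotonic references, witness and recall of stable heap predicates, and a node that requires a proposition. A heap is a memory of typed cells with a next free address; $h_0\preceq h_1$ means that the references of $h_0$ stay allocated and evolve along their preorders. Let $\theta : M(\alpha)\to W(\alpha)$ be the monad morphism to weakest-precondition transformers that gives each operation its specification (witnessing $p$ requires $p$ and yields a token $\mathrm{witnessed}\,p$; recalling $p$ requires the token and yields $p$; the tokens are arbitrary propositions indexed by heap predicates). $\mathsf{MST}\,\alpha\,pre\,post$ is the type of those $m\in M(\alpha)$ such that $\theta(m)$ is implied by: $pre$ holds in the initial heap $h_0$, and the continuation post-condition holds for all $v,h_1$ with $h_0\preceq h_1$ and $post\,h_0\,v\,h_1$. A distinguished reference stores a label (private, shareable or encapsulated) for every address, the two last labels being permanent. $\mathsf{LR}\,\alpha\,pre\,post$ is $\mathsf{MST}$ with the global invariant added to the pre- and post-condition: contained references point to contained references, shareable references point to shareable references, the label map is contained and private, and unallocated addresses are private. Full ground types are built from unit, integers, booleans, sums, pairs, references and mutable linked lists. A triple $(\mathcal I,\varphi,\preccurlyeq)$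 consists of a heap invariant, a predicate on references and a preorder on heaps. The concrete triple $c=(\mathcal I_c,\varphi_c,\preccurlyeq_c)$ has as $\mathcal I_c$ the global invariant, as $\varphi_c(r)$ that $r$ was witnessed to be contained and to be shareable, and as $h_0\preccurlyeq_c h_1$ that $h_0\preceq h_1$, that apart from the label map only shareable and encapsulated references are modified, and that existing references keep their labels. A source interface $I^S$ consists of a type $\mathsf{ctype}(p)$ for each triple $p$, a tree of the pre- and post-conditions that occur in it, a tree of dynamic checks (higher-order contracts) for them at $c$, for each $p$ a safe import $\mathsf{imp}_p$ into $\mathsf{ctype}(p)$ from an intermediate type $\mathsf{ityp}(p)$ given such checks, preserving for every predicate on references that all references in a value satisfy it, and a post-condition $\psi$. The compiled interface $I^S{\downarrow}$ is $p\mapsto \mathsf{ityp}(p)$. A partial source program $P$ is a function $\mathsf{ctype}(c)\to \mathsf{LR}\ \mathbb Z\ \top\ \psi$, a source context $C^S$ is a value of $\mathsf{ctype}(c)$, and $C^S[P]=P(C^S)$. A target context $C^T$ is a function that, for every triple $p$ and every implementation of alloc, read and write on full ground types whose specifications mention only $p$, returns a value of $\mathsf{ityp}(p)$. Write $\widehat{C^T}\in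 \mathsf{ityp}(c)$ for its instance at $c$ with the operations: allocate and label as shareable, read, write. A partial target program is a function $P^T : \mathsf{ityp}(c)\to\mathsf{LR}\ \mathbb Z\ \top\ \top$, and $C^T[P^T]=P^T(\widehat{C^T})$. Compilation is $P{\downarrow} = (x\mapsto P(\mathsf{imp}_c(x)))$ and back-translation is $C^T{\uparrow}=\mathsf{imp}_c(\widehat{C^T})$. The behaviour of a whole program with underlying computation $m$ is the relation $\mathsf{beh}\,(h_0,r,h_1) :\iff \forall p.\ \theta(m)\,p\,h_0\Rightarrow p\,r\,h_1$. *Theorem.* (1) For every source interface $I^S$ and every target context $C^T$ for $I^S{\downarrow}$ there is a source context $C^S$ for $I^S$, namely $C^S=C^T{\uparrow}$, such that for every partial source program $P$ for $I^S$, $\mathsf{beh}(C^T[P{\downarrow}])=\mathsf{beh}(C^S[P])$. (2) The same holds when the context has initial control. Here the interface describes the type of the program, with an export to the intermediate type, which preserves in the same way that all references in a value satisfy a predicate, instead of an import; a partial source program is a value of that type at $c$ all of whose references satisfy $\varphi_c$ (no constraint for function types); a source context is a function that maps a value of that type whose references satisfy $\varphi_c$ to a computation of an integer in $\mathsf{LR}$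 with post-condition $\preccurlyeq_c$; a target context maps a triple and operations as above to a function from the intermediate type to computations of an integer in $\mathsf{MST}$ that require $\mathcal I$ and that $\varphi$ holds of the references in the argument, and ensure $\mathcal I$ and $\preccurlyeq$; whole programs apply the context to the program; compilation exports the program, and the back-translation of $C^T$ exports its argument and applies the instance of $C^T$ to it. (3) The same as (1) holds for syntactic target contexts: if the intermediate type of $I^S$ is the interpretation of a type of a deeply embedded total simply typed $\lambda$-calculus with references to full ground types, target contexts are closed syntactic values of that type with their typing derivations, and target linking and back-translation first translate the typed value into a target context as in (1), by recursion on the typing derivation. -/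

import Mathlib

universe u v s

namespace SecRef

/-! ## Preorders, full ground types, references -/

/-- A preorder on a type: a relation with its reflexivity and transitivity. -/
structure Preord (a : Type u) where
  rel : a → a → Prop
  refl : ∀ x, rel x x
  trans : ∀ x y z, rel x y → rel y z → rel x z

/-- The preorder that relates everything (the one of ordinary ML-style references). -/
def Preord.triv (a : Type u) : Preord a := ⟨fun _ _ => True, fun _ => trivial, fun _ _ _ _ _ => trivial⟩

/-- Codes of full ground types: what a shareable reference may store. -/
inductive FullGround : Type
  | unit | int | bool
  | sum (a b : FullGround)
  | pair (a b : FullGround)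
  | ref (a : FullGround)
  | llist (a : FullGround)

/-- The kinds of monotonic references: `gen a rel` is the kind of `mref a rel`, for any type and any
preorder; `ground t` is the kind of `ref t`, a reference to a full ground type with the trivial preorder.
Full ground types are recorded by their code because equality of codes, unlike equality of types,
can be decided: type formers are not provably injective. -/
inductive Kind : Type 1
  | ground (t : FullGround)
  | gen (a : Type) (rel : Preord a)

/-- A reference: an address tagged with the kind of the cell. -/
structure MRef (k : Kind) : Type where
  addr : ℕ+

/-- Mutable linked lists with values in `a`, where `t` is the code of `a`. -/
inductive LList (a : Type) (t : FullGround) : Type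
  | nil
  | cons (v : a) (tl : MRef (.ground (.llist t)))

/-- The type that a full ground code stands for. -/
def FullGround.toType : FullGround → Type
  | .unit => Unit
  | .int => ℤ
  | .bool => Bool
  | .sum a b => a.toType ⊕ b.toType
  | .pair a b => a.toType × b.toType
  | .ref a => MRef (.ground a)
  | .llist a => LList a.toType a

/-- The type of the values stored in a cell. -/
def Kind.El : Kind → Type
  | .ground t => t.toType
  | .gen a _ => a

/-- The preorder along which the value of a cell evolves. -/
def Kind.preord : (k : Kind) → Preord k.El
  | .ground t => Preord.triv t.toType
  | .gen _ rel => rel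

/-- Predicates on references of all kinds. -/
def MRefPred : Type 1 := (k : Kind) → MRef k → Prop

/-- Every reference occurring in a value of full ground type satisfies `φ`
(references are not followed into the heap). -/
def forallRefs (φ : MRefPred) : (t : FullGround) → t.toType → Prop
  | .unit, _ => True
  | .int, _ => True
  | .bool, _ => True
  | .sum a _, .inl x => forallRefs φ a x
  | .sum _ b, .inr x => forallRefs φ b x
  | .pair a b, (x, y) => forallRefs φ a x ∧ forallRefs φ b y
  | .ref a, r => φ (.ground a) r
  | .llist _, .nil => True
  | .llist a, .cons x tl => forallRefs φ a x ∧ φ (.ground (.llist a)) tl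

/-! ## Monotonic heaps -/

/-- The content of an allocated address. -/
structure Cell : Type 1 where
  kind : Kind
  val : kind.El

/-- Heaps: finitely supported memories of typed cells, with the next free address. -/
structure Heap : Type 1 where
  next : ℕ+
  mem : ℕ+ → Option Cell
  free : ∀ n, next ≤ n → mem n = none

variable {k : Kind}

/-- `h.Maps r v`: the heap contains `r`, with `sel h r = v`. -/
def Heap.Maps (h : Heap) (r : MRef k) (v : k.El) : Prop := h.mem r.addr = some ⟨k, v⟩

/-- The heap contains the reference, at the right type and preorder. -/
def Heap.Contains (h : Heap) (r : MRef k) : Prop := ∃ v, h.Maps r v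

theorem Heap.Maps.lt {h : Heap} {r : MRef k} {v : k.El} (hv : h.Maps r v) : r.addr < h.next := by
  by_contra hn
  have := h.free r.addr (not_lt.mp hn)
  rw [Heap.Maps, this] at hv
  cases hv

theorem Heap.Maps.unique {h : Heap} {r : MRef k} {v v' : k.El} (hv : h.Maps r v) (hv' : h.Maps r v') :
    v = v' := by
  rw [Heap.Maps] at hv hv'
  rw [hv] at hv'
  cases hv'
  rfl

/-- Writing a contained reference. -/
def Heap.write (h : Heap) (r : MRef k) (hr : h.Contains r) (v : k.El) : Heap where
  next := h.next
  mem := Function.update h.mem r.addr (some ⟨k, v⟩)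
  free := by
    intro n hn
    obtain ⟨v0, h0⟩ := hr
    have hlt := h0.lt
    rw [Function.update_of_ne (ne_of_gt (lt_of_lt_of_le hlt hn))]
    exact h.free n hn

/-- The heap after allocating a cell at the next free address. -/
def Heap.alloc (h : Heap) (k : Kind) (x : k.El) : Heap where
  next := h.next + 1
  mem := Function.update h.mem h.next (some ⟨k, x⟩)
  free := by
    intro n hn
    have hlt : h.next < n := lt_of_lt_of_le (PNat.lt_add_right h.next 1) hn
    rw [Function.update_of_ne (ne_of_gt hlt)]
    exact h.free n hlt.le

/-- The preorder on heaps: references stay allocated and evolve along their preorders. -/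
def Heap.Le (h₀ h₁ : Heap) : Prop :=
  ∀ (k : Kind) (r : MRef k) (v₀ : k.El), h₀.Maps r v₀ → ∃ v₁, h₁.Maps r v₁ ∧ k.preord.rel v₀ v₁

/-- Stable heap predicates. -/
def StablePred : Type 1 := {p : Heap → Prop // ∀ h₀ h₁, p h₀ → h₀.Le h₁ → p h₁}

/-! ## Monotonic state as a Dijkstra monad -/

/-- The free monad of monotonic state. The last constructor accounts for the partiality that comes
from pre-conditions: its continuation may use a proof of `P`. -/
inductive MSTRepr (α : Type u) : Type (max 1 u)
  | ret (v : α)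
  | read (k : Kind) (r : MRef k) (c : k.El → MSTRepr α)
  | write (k : Kind) (r : MRef k) (v : k.El) (c : MSTRepr α)
  | alloc (k : Kind) (x : k.El) (c : MRef k → MSTRepr α)
  | witnessOp (p : StablePred) (c : Unit → MSTRepr α)
  | recallOp (p : StablePred) (c : Unit → MSTRepr α)
  | require (P : Prop) (c : P → MSTRepr α)

def MSTRepr.bind {α : Type u} {β : Type v} : MSTRepr α → (α → MSTRepr β) → MSTRepr β
  | .ret v, f => f v
  | .read k r c, f => .read k r fun x => (c x).bind f
  | .write k r v c, f => .write k r v (c.bind f)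
  | .alloc k x c, f => .alloc k x fun r => (c r).bind f
  | .witnessOp p c, f => .witnessOp p fun x => (c x).bind f
  | .recallOp p c, f => .recallOp p fun x => (c x).bind f
  | .require P c, f => .require P fun x => (c x).bind f

/-- Specifications: monotonic weakest pre-condition transformers. -/
structure MSTW (α : Type u) where
  wp : (α → Heap → Prop) → Heap → Prop
  mono : ∀ p q, (∀ v h, p v h → q v h) → ∀ h, wp p h → wp q h

def MSTW.ret {α : Type u} (v : α) : MSTW α := ⟨fun p h => p v h, fun _ _ hpq h => hpq v h⟩

def MSTW.bind {α : Type u} {β : Type v} (a : MSTW α) (f : α → MSTW β) : MSTW β :=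
  ⟨fun p => a.wp fun v h => (f v).wp p h,
    fun p q hpq h => a.mono _ _ (fun v h' => (f v).mono p q hpq h') h⟩

/-- `a.Le b`: the specification `b` implies the specification `a`. -/
def MSTW.Le {α : Type u} (a b : MSTW α) : Prop := ∀ p h, b.wp p h → a.wp p h

def readW (r : MRef k) : MSTW k.El :=
  ⟨fun p h => ∃ v, h.Maps r v ∧ p v h, fun _ _ hpq h ⟨v, hv, hp⟩ => ⟨v, hv, hpq v h hp⟩⟩

def writeW (r : MRef k) (v : k.El) : MSTW Unit :=
  ⟨fun p h => ∃ hr : h.Contains r, (∀ v₀, h.Maps r v₀ → k.preord.rel v₀ v) ∧ p () (h.write r hr v),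
    fun _ _ hpq _ ⟨hr, hv, hp⟩ => ⟨hr, hv, hpq _ _ hp⟩⟩

def allocW (k : Kind) (x : k.El) : MSTW (MRef k) :=
  ⟨fun p h => p ⟨h.next⟩ (h.alloc k x), fun _ _ hpq _ hp => hpq _ _ hp⟩

/-- The tokens `witnessed p`: heap-independent propositions indexed by heap predicates. They are
abstract; everything below is parametric in them. -/
abbrev Tokens : Type 1 := (Heap → Prop) → Prop

variable (w : Tokens)

def witnessW (p : StablePred) : MSTW Unit :=
  ⟨fun post h => p.1 h ∧ (w p.1 → post () h), fun _ _ hpq h hp => ⟨hp.1, fun hw => hpq _ h (hp.2 hw)⟩⟩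

def recallW (p : StablePred) : MSTW Unit :=
  ⟨fun post h => w p.1 ∧ (p.1 h → post () h), fun _ _ hpq h hp => ⟨hp.1, fun hw => hpq _ h (hp.2 hw)⟩⟩

def requireW (P : Prop) : MSTW (PLift P) :=
  ⟨fun post h => ∃ hP : P, post ⟨hP⟩ h, fun _ _ hpq h ⟨hP, hp⟩ => ⟨hP, hpq _ h hp⟩⟩

/-- The monad morphism from computations to specifications. -/
def theta {α : Type u} : MSTRepr α → MSTW α
  | .ret v => MSTW.ret v
  | .read _ r c => (readW r).bind fun x => theta (c x)
  | .write _ r v c => (writeW r v).bind fun _ => theta c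
  | .alloc k x c => (allocW k x).bind fun r => theta (c r)
  | .witnessOp p c => (witnessW w p).bind fun x => theta (c x)
  | .recallOp p c => (recallW w p).bind fun x => theta (c x)
  | .require P c => (requireW P).bind fun x => theta (c x.down)

/-- The Dijkstra monad: computations that satisfy the specification `W`. -/
def MSTDM (α : Type u) (W : MSTW α) : Type (max 1 u) := {m : MSTRepr α // (theta w m).Le W}

/-- The specification given by a pre- and a post-condition. -/
def prePostW {α : Type u} (pre : Heap → Prop) (post : Heap → α → Heap → Prop) : MSTW α :=
  ⟨fun p h₀ => pre h₀ ∧ ∀ v h₁, h₀.Le h₁ ∧ post h₀ v h₁ → p v h₁,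
    fun _ _ hpq _ hp => ⟨hp.1, fun v h₁ hv => hpq v h₁ (hp.2 v h₁ hv)⟩⟩

/-- The effect `MST`. -/
def MST (α : Type u) (pre : Heap → Prop) (post : Heap → α → Heap → Prop) : Type (max 1 u) :=
  MSTDM w α (prePostW pre post)

theorem theta_bind {α : Type u} {β : Type v} (m : MSTRepr α) (f : α → MSTRepr β)
    (p : β → Heap → Prop) (h : Heap) :
    (theta w (m.bind f)).wp p h ↔ (theta w m).wp (fun v h' => (theta w (f v)).wp p h') h := by
  induction m generalizing h with
  | ret v => exact Iff.rfl
  | read k r c ih => exact exists_congr fun v => and_congr_right fun _ => ih v h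
  | write k r v c ih => exact exists_congr fun hr => and_congr_right fun _ => ih _
  | alloc k x c ih => exact ih _ _
  | witnessOp q c ih => exact and_congr_right fun _ => imp_congr_right fun _ => ih _ _
  | recallOp q c ih => exact and_congr_right fun _ => imp_congr_right fun _ => ih _ _
  | require P c ih => exact exists_congr fun hP => ih _ _

/-- Subsumption: strengthen the pre-condition and weaken the post-condition. -/
def MST.weaken {w : Tokens} {α : Type u} {pre pre' : Heap → Prop} {post post' : Heap → α → Heap → Prop}
    (m : MST w α pre post) (hpre : ∀ h, pre' h → pre h)
    (hpost : ∀ h₀ v h₁, pre' h₀ → post h₀ v h₁ → post' h₀ v h₁) : MST w α pre' post' :=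
  ⟨m.1, fun p h hp => m.2 p h ⟨hpre h hp.1, fun v h₁ hv => hp.2 v h₁ ⟨hv.1, hpost h v h₁ hp.1 hv.2⟩⟩⟩

/-! ## Labels -/

inductive Label : Type
  | priv | shareable | encapsulated

/-- A private reference may be relabelled; the two other labels are permanent. -/
def Label.Le (l l' : Label) : Prop := l = .priv ∨ l = l'

def labelMapPreord : Preord (ℕ+ → Label) where
  rel m₀ m₁ := ∀ n, (m₀ n).Le (m₁ n)
  refl _ _ := Or.inr rfl
  trans m₀ m₁ m₂ h h' n := by
    rcases h n with h1 | h1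
    · exact Or.inl h1
    · rcases h' n with h2 | h2
      · exact Or.inl (h1.trans h2)
      · exact Or.inr (h1.trans h2)

/-- The type of the ghost reference that stores the labels of all addresses. -/
abbrev LabelMapRef : Type := MRef (.gen (ℕ+ → Label) labelMapPreord)

variable (lm : LabelMapRef)

/-- The label map is contained in the heap and gives the label `l` to the address `n`. -/
def HasLabel (l : Label) (n : ℕ+) (h : Heap) : Prop :=
  ∃ m : ℕ+ → Label, Heap.Maps (k := .gen _ labelMapPreord) h lm m ∧ m n = l

def IsPrivate (r : MRef k) (h : Heap) : Prop := HasLabel lm .priv r.addr h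
def IsShareable (r : MRef k) (h : Heap) : Prop := HasLabel lm .shareable r.addr h
def IsEncaps (r : MRef k) (h : Heap) : Prop := HasLabel lm .encapsulated r.addr h

/-- Apart from the label map, only shareable and encapsulated references are modified. -/
def ModifShareableAndEncaps (h₀ h₁ : Heap) : Prop :=
  ∀ (k : Kind) (r : MRef k) (v : k.El), h₀.Maps r v → r.addr ≠ lm.addr →
    ¬ (IsShareable lm r h₀ ∨ IsEncaps lm r h₀) → h₁.Maps r v

/-- Existing references keep their label. -/
def SameLabels (h₀ h₁ : Heap) : Prop :=
  ∀ (k : Kind) (r : MRef k), h₀.Contains r → ∀ l, HasLabel lm l r.addr h₀ ↔ HasLabel lm l r.addr h₁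

/-- The references that satisfy `pred` point only to references that satisfy `pred`. -/
def TransForallRefsHeap (h : Heap) (pred : Heap → MRefPred) : Prop :=
  ∀ (t : FullGround) (r : MRef (.ground t)) (v : t.toType),
    Heap.Maps (k := .ground t) h r v → pred h (.ground t) r → forallRefs (pred h) t v

/-- The global invariant of labeled references. -/
def lrInv (h : Heap) : Prop :=
  TransForallRefsHeap h (fun h _ r => h.Contains r) ∧
  TransForallRefsHeap h (fun h _ r => IsShareable lm r h) ∧
  h.Contains lm ∧
  IsPrivate lm lm h ∧
  ∀ n, h.next ≤ n → HasLabel lm .priv n h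

/-- The effect `LR`. -/
def LR (α : Type u) (pre : Heap → Prop) (post : Heap → α → Heap → Prop) : Type (max 1 u) :=
  MST w α (fun h₀ => lrInv lm h₀ ∧ pre h₀) (fun h₀ r h₁ => lrInv lm h₁ ∧ post h₀ r h₁)

/-! ## The three predicates, and the operations of unverified code -/

/-- A global invariant, a predicate on references and a preorder on heaps. -/
structure ThreeP : Type 1 where
  inv : Heap → Prop
  phi : MRefPred
  hrel : Preord Heap

def PolyAlloc (P : ThreeP) : Type 1 :=
  (t : FullGround) → (x : t.toType) →
    MST w (MRef (.ground t)) (fun h₀ => P.inv h₀ ∧ forallRefs P.phi t x)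
      (fun h₀ r h₁ => P.hrel.rel h₀ h₁ ∧ P.inv h₁ ∧ P.phi (.ground t) r)

def PolyRead (P : ThreeP) : Type 1 :=
  (t : FullGround) → (r : MRef (.ground t)) →
    MST w t.toType (fun h₀ => P.inv h₀ ∧ P.phi (.ground t) r)
      (fun h₀ v h₁ => P.hrel.rel h₀ h₁ ∧ P.inv h₁ ∧ forallRefs P.phi t v)

def PolyWrite (P : ThreeP) : Type 1 :=
  (t : FullGround) → (r : MRef (.ground t)) → (v : t.toType) →
    MST w Unit (fun h₀ => P.inv h₀ ∧ P.phi (.ground t) r ∧ forallRefs P.phi t v)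
      (fun h₀ _ h₁ => P.hrel.rel h₀ h₁ ∧ P.inv h₁)

/-! ### Facts about heaps and labels -/

theorem Heap.Le.refl (h : Heap) : h.Le h := fun k _ v hv => ⟨v, hv, k.preord.refl v⟩

theorem Heap.Le.trans {h₀ h₁ h₂ : Heap} (a : h₀.Le h₁) (b : h₁.Le h₂) : h₀.Le h₂ := by
  intro k r v hv
  obtain ⟨v1, hv1, r1⟩ := a k r v hv
  obtain ⟨v2, hv2, r2⟩ := b k r v1 hv1
  exact ⟨v2, hv2, k.preord.trans _ _ _ r1 r2⟩

theorem Heap.Le.contains {h₀ h₁ : Heap} (a : h₀.Le h₁) {r : MRef k} (hr : h₀.Contains r) :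
    h₁.Contains r := by
  obtain ⟨v, hv⟩ := hr
  obtain ⟨v1, hv1, _⟩ := a k r v hv
  exact ⟨v1, hv1⟩

theorem Heap.maps_write_ne {h : Heap} {r : MRef k} (hr : h.Contains r) (v : k.El) {k' : Kind}
    {r' : MRef k'} (hne : r'.addr ≠ r.addr) (v' : k'.El) :
    (h.write r hr v).Maps r' v' ↔ h.Maps r' v' := by
  simp only [Heap.Maps, Heap.write, Function.update_of_ne hne]

theorem Heap.maps_write_eq {h : Heap} {r : MRef k} (hr : h.Contains r) (v : k.El) :
    (h.write r hr v).Maps r v := by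
  simp only [Heap.Maps, Heap.write, Function.update_self]

theorem Heap.maps_alloc_ne {h : Heap} (x : k.El) {k' : Kind}
    {r' : MRef k'} (hne : r'.addr ≠ h.next) (v' : k'.El) :
    (h.alloc k x).Maps r' v' ↔ h.Maps r' v' := by
  simp only [Heap.Maps, Heap.alloc, Function.update_of_ne hne]

theorem Heap.maps_alloc_eq (h : Heap) (x : k.El) :
    (h.alloc k x).Maps (⟨h.next⟩ : MRef k) x := by
  simp only [Heap.Maps, Heap.alloc, Function.update_self]

theorem Heap.kind_eq {h : Heap} {k k' : Kind} {r : MRef k} {r' : MRef k'} {v : k.El} {v' : k'.El}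
    (ha : r.addr = r'.addr) (hv : h.Maps r v) (hv' : h.Maps r' v') : (⟨k, v⟩ : Cell) = ⟨k', v'⟩ := by
  rw [Heap.Maps] at hv hv'
  rw [ha, hv'] at hv
  exact (Option.some.inj hv).symm

theorem Heap.le_write {h : Heap} {r : MRef k} (hr : h.Contains r) (v : k.El)
    (hv : ∀ v₀, h.Maps r v₀ → k.preord.rel v₀ v) : h.Le (h.write r hr v) := by
  intro k' r' v' hv'
  by_cases hne : r'.addr = r.addr
  · obtain ⟨v0, h0⟩ := hr
    have hc := Heap.kind_eq hne hv' h0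
    cases hc
    have : r' = r := by cases r; cases r'; simpa using hne
    subst this
    exact ⟨v, Heap.maps_write_eq _ _, hv _ hv'⟩
  · exact ⟨v', (Heap.maps_write_ne hr v hne v').2 hv', k'.preord.refl _⟩

theorem Heap.le_alloc (h : Heap) (x : k.El) : h.Le (h.alloc k x) := by
  intro k' r' v' hv'
  exact ⟨v', (Heap.maps_alloc_ne x (ne_of_lt hv'.lt) v').2 hv', k'.preord.refl _⟩

theorem forallRefs_mono {φ ψ : MRefPred} (hφ : ∀ k r, φ k r → ψ k r) :
    ∀ (t : FullGround) (x : t.toType), forallRefs φ t x → forallRefs ψ t x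
  | .unit, _ => fun _ => trivial
  | .int, _ => fun _ => trivial
  | .bool, _ => fun _ => trivial
  | .sum a _, .inl x => fun h => forallRefs_mono hφ a x h
  | .sum _ b, .inr x => fun h => forallRefs_mono hφ b x h
  | .pair a b, (x, y) => fun h => ⟨forallRefs_mono hφ a x h.1, forallRefs_mono hφ b y h.2⟩
  | .ref _, _ => fun h => hφ _ _ h
  | .llist _, .nil => fun _ => trivial
  | .llist a, .cons x _ => fun h => ⟨forallRefs_mono hφ a x h.1, hφ _ _ h.2⟩

variable {lm}

theorem HasLabel.stable {l : Label} (hl : l ≠ .priv) {n : ℕ+} {h₀ h₁ : Heap} (hle : h₀.Le h₁)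
    (h : HasLabel lm l n h₀) : HasLabel lm l n h₁ := by
  obtain ⟨m, hm, hn⟩ := h
  obtain ⟨m1, hm1, hr⟩ := hle _ lm m hm
  refine ⟨m1, hm1, ?_⟩
  rcases hr n with h1 | h1
  · exact absurd (hn.symm.trans h1) hl
  · exact h1.symm.trans hn

variable (lm)

/-- Being contained and being shareable are stable. -/
def containsPred (r : MRef k) : StablePred :=
  ⟨fun h => h.Contains r, fun _ _ h hle => hle.contains h⟩

def shareablePred (r : MRef k) : StablePred :=
  ⟨fun h => IsShareable lm r h, fun _ _ h hle => HasLabel.stable (by simp) hle h⟩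

/-! ### The three concrete predicates -/

/-- References that were witnessed to be contained and shareable. -/
def phiC : MRefPred := fun _ r =>
  w (fun h => h.Contains r) ∧ w (fun h => IsShareable lm r h)

/-- The heap evolves, only shareable and encapsulated references are modified, and labels are kept. -/
def hrelC : Preord Heap where
  rel h₀ h₁ := h₀.Le h₁ ∧ ModifShareableAndEncaps lm h₀ h₁ ∧ SameLabels lm h₀ h₁
  refl h := ⟨Heap.Le.refl h, fun _ _ _ hv _ _ => hv, fun _ _ _ _ => Iff.rfl⟩
  trans h₀ h₁ h₂ a b := by
    refine ⟨a.1.trans b.1, ?_, ?_⟩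
    · intro k r v hv hne hl
      refine b.2.1 k r v (a.2.1 k r v hv hne hl) hne ?_
      have hs := a.2.2 k r ⟨v, hv⟩
      rintro (h | h)
      · exact hl (Or.inl ((hs _).2 h))
      · exact hl (Or.inr ((hs _).2 h))
    · intro k r hr l
      exact (a.2.2 k r hr l).trans (b.2.2 k r (a.1.contains hr) l)

def concrete : ThreeP := ⟨lrInv lm, phiC w lm, hrelC lm⟩

/-! ### The operations on the side of the linker -/

/-- Recover that a reference with both tokens is contained and shareable. -/
def recallRef {α : Type u} (r : MRef k) (c : MSTRepr α) : MSTRepr α :=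
  .recallOp (containsPred r) fun _ => .recallOp (shareablePred lm r) fun _ => c

def witnessRef {α : Type u} (r : MRef k) (c : MSTRepr α) : MSTRepr α :=
  .witnessOp (containsPred r) fun _ => .witnessOp (shareablePred lm r) fun _ => c

def recallRefs {α : Type u} : (t : FullGround) → t.toType → MSTRepr α → MSTRepr α
  | .unit, _, c => c
  | .int, _, c => c
  | .bool, _, c => c
  | .sum a _, .inl x, c => recallRefs a x c
  | .sum _ b, .inr x, c => recallRefs b x c
  | .pair a b, (x, y), c => recallRefs a x (recallRefs b y c)
  | .ref a, r, c => recallRef (k := .ground a) lm r c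
  | .llist _, .nil, c => c
  | .llist a, .cons x tl, c => recallRefs a x (recallRef lm tl c)

def witnessRefs {α : Type u} : (t : FullGround) → t.toType → MSTRepr α → MSTRepr α
  | .unit, _, c => c
  | .int, _, c => c
  | .bool, _, c => c
  | .sum a _, .inl x, c => witnessRefs a x c
  | .sum _ b, .inr x, c => witnessRefs b x c
  | .pair a b, (x, y), c => witnessRefs a x (witnessRefs b y c)
  | .ref a, r, c => witnessRef (k := .ground a) lm r c
  | .llist _, .nil, c => c
  | .llist a, .cons x tl, c => witnessRefs a x (witnessRef lm tl c)

/-- Label a reference as shareable, by updating the label map. -/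
def labelShareable {α : Type u} (r : MRef k) (c : MSTRepr α) : MSTRepr α :=
  .read (.gen (ℕ+ → Label) labelMapPreord) lm fun (m : ℕ+ → Label) =>
    .write (.gen (ℕ+ → Label) labelMapPreord) lm (Function.update m r.addr .shareable) c

theorem theta_recallRef {α : Type u} (r : MRef k) (c : MSTRepr α) (p : α → Heap → Prop) (h : Heap)
    (hr : phiC w lm k r) (hc : h.Contains r → IsShareable lm r h → (theta w c).wp p h) :
    (theta w (recallRef lm r c)).wp p h :=
  ⟨hr.1, fun h1 => ⟨hr.2, fun h2 => hc h1 h2⟩⟩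

theorem theta_witnessRef {α : Type u} (r : MRef k) (c : MSTRepr α) (p : α → Heap → Prop) (h : Heap)
    (h1 : h.Contains r) (h2 : IsShareable lm r h) (hc : phiC w lm k r → (theta w c).wp p h) :
    (theta w (witnessRef lm r c)).wp p h :=
  ⟨h1, fun w1 => ⟨h2, fun w2 => hc ⟨w1, w2⟩⟩⟩

theorem theta_recallRefs {α : Type u} (p : α → Heap → Prop) (h : Heap) :
    ∀ (t : FullGround) (x : t.toType) (c : MSTRepr α), forallRefs (phiC w lm) t x →
      (forallRefs (fun _ r => h.Contains r) t x → forallRefs (fun _ r => IsShareable lm r h) t x →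
        (theta w c).wp p h) → (theta w (recallRefs lm t x c)).wp p h
  | .unit, _, _, _, hc => hc trivial trivial
  | .int, _, _, _, hc => hc trivial trivial
  | .bool, _, _, _, hc => hc trivial trivial
  | .sum a _, .inl x, c, hx, hc => theta_recallRefs p h a x c hx hc
  | .sum _ b, .inr x, c, hx, hc => theta_recallRefs p h b x c hx hc
  | .pair a b, (x, y), c, hx, hc =>
      theta_recallRefs p h a x _ hx.1 fun h1 h2 =>
        theta_recallRefs p h b y c hx.2 fun h3 h4 => hc ⟨h1, h3⟩ ⟨h2, h4⟩
  | .ref a, r, c, hx, hc => theta_recallRef (k := .ground a) w lm r c p h hx hc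
  | .llist _, .nil, _, _, hc => hc trivial trivial
  | .llist a, .cons x tl, c, hx, hc =>
      theta_recallRefs p h a x _ hx.1 fun h1 h2 =>
        theta_recallRef w lm tl c p h hx.2 fun h3 h4 => hc ⟨h1, h3⟩ ⟨h2, h4⟩

theorem theta_witnessRefs {α : Type u} (p : α → Heap → Prop) (h : Heap) :
    ∀ (t : FullGround) (x : t.toType) (c : MSTRepr α), forallRefs (fun _ r => h.Contains r) t x →
      forallRefs (fun _ r => IsShareable lm r h) t x →
      (forallRefs (phiC w lm) t x → (theta w c).wp p h) → (theta w (witnessRefs lm t x c)).wp p h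
  | .unit, _, _, _, _, hc => hc trivial
  | .int, _, _, _, _, hc => hc trivial
  | .bool, _, _, _, _, hc => hc trivial
  | .sum a _, .inl x, c, h1, h2, hc => theta_witnessRefs p h a x c h1 h2 hc
  | .sum _ b, .inr x, c, h1, h2, hc => theta_witnessRefs p h b x c h1 h2 hc
  | .pair a b, (x, y), c, h1, h2, hc =>
      theta_witnessRefs p h a x _ h1.1 h2.1 fun h3 =>
        theta_witnessRefs p h b y c h1.2 h2.2 fun h4 => hc ⟨h3, h4⟩
  | .ref a, r, c, h1, h2, hc => theta_witnessRef (k := .ground a) w lm r c p h h1 h2 hc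
  | .llist _, .nil, _, _, _, hc => hc trivial
  | .llist a, .cons x tl, c, h1, h2, hc =>
      theta_witnessRefs p h a x _ h1.1 h2.1 fun h3 =>
        theta_witnessRef w lm tl c p h h1.2 h2.2 fun h4 => hc ⟨h3, h4⟩

theorem hasLabel_congr {h₀ h₁ : Heap}
    (he : ∀ m, Heap.Maps (k := .gen _ labelMapPreord) h₁ lm m ↔ Heap.Maps (k := .gen _ labelMapPreord) h₀ lm m)
    (l : Label) (n : ℕ+) : HasLabel lm l n h₁ ↔ HasLabel lm l n h₀ :=
  exists_congr fun m => and_congr_left fun _ => he m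

theorem lrInv_write {h : Heap} (hi : lrInv lm h) {t : FullGround} {r : MRef (.ground t)}
    (hr : h.Contains r) (hs : IsShareable lm r h) {v : t.toType}
    (h1 : forallRefs (fun _ r => h.Contains r) t v)
    (h2 : forallRefs (fun _ r => IsShareable lm r h) t v) :
    lrInv lm (Heap.write (k := .ground t) h r hr v) ∧
      (hrelC lm).rel h (Heap.write (k := .ground t) h r hr v) := by
  obtain ⟨i1, i2, ⟨m, hm⟩, i4, i5⟩ := hi
  have hne : lm.addr ≠ r.addr := by
    intro ha
    obtain ⟨v0, h0⟩ := hr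
    have := Heap.kind_eq ha hm h0
    cases this
  have hle : h.Le (Heap.write (k := .ground t) h r hr v) :=
    Heap.le_write (k := .ground t) hr v fun _ _ => trivial
  have hl : ∀ l n, HasLabel lm l n (Heap.write (k := .ground t) h r hr v) ↔ HasLabel lm l n h :=
    hasLabel_congr lm fun m => Heap.maps_write_ne (k := .ground t) hr v hne m
  refine ⟨⟨?_, ?_, hle.contains ⟨m, hm⟩, (hl _ _).2 i4, fun n hn => (hl _ _).2 (i5 n hn)⟩,
    hle, ?_, fun k r' _ l => (hl l _).symm⟩
  · intro t' r' v' hv' _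
    refine forallRefs_mono (φ := fun _ r => h.Contains r) (fun _ _ hc => hle.contains hc) t' v' ?_
    by_cases ha : r'.addr = r.addr
    · have := Heap.kind_eq ha hv' (Heap.maps_write_eq (k := .ground t) hr v)
      cases this
      exact h1
    · have h0 := (Heap.maps_write_ne (k := .ground t) (k' := .ground t') hr v ha v').1 hv'
      exact i1 t' r' v' h0 ⟨_, h0⟩
  · intro t' r' v' hv' hs'
    refine forallRefs_mono (φ := fun _ r => IsShareable lm r h) (fun _ _ hc => (hl _ _).2 hc) t' v' ?_
    by_cases ha : r'.addr = r.addr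
    · have := Heap.kind_eq ha hv' (Heap.maps_write_eq (k := .ground t) hr v)
      cases this
      exact h2
    · have h0 := (Heap.maps_write_ne (k := .ground t) (k' := .ground t') hr v ha v').1 hv'
      exact i2 t' r' v' h0 ((hl _ _).1 hs')
  · intro k r' v' hv' _ hnl
    have ha : r'.addr ≠ r.addr := by
      intro ha
      apply hnl
      left
      show HasLabel lm .shareable r'.addr h
      rw [ha]
      exact hs
    exact (Heap.maps_write_ne (k := .ground t) hr v ha v').2 hv'

/-- `write` for the context: the write of labeled references. -/
def ctxWrite : PolyWrite w (concrete w lm) := fun t r v =>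
  ⟨recallRef lm r (recallRefs lm t v (.write (.ground t) r v (.ret ()))), by
    intro p h hp
    obtain ⟨⟨hi, hr, hv⟩, hpost⟩ := hp
    refine theta_recallRef w lm r _ p h hr fun c1 s1 => theta_recallRefs w lm p h t v _ hv fun c2 s2 => ?_
    have hw := lrInv_write lm hi c1 s1 c2 s2
    exact ⟨c1, fun _ _ => trivial, hpost () _ ⟨hw.2.1, hw.2, hw.1⟩⟩⟩

/-- `read` for the context: the read of labeled references. -/
def ctxRead : PolyRead w (concrete w lm) := fun t r =>
  ⟨recallRef lm r (.read (.ground t) r fun v => witnessRefs lm t v (.ret v)), by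
    intro p h hp
    obtain ⟨⟨hi, hr⟩, hpost⟩ := hp
    refine theta_recallRef w lm r _ p h hr fun c1 s1 => ?_
    obtain ⟨v, hv⟩ := c1
    refine ⟨v, hv, ?_⟩
    refine theta_witnessRefs w lm p h t v _ (hi.1 t r v hv ⟨v, hv⟩) (hi.2.1 t r v hv s1) fun hφ => ?_
    exact hpost v h ⟨Heap.Le.refl h, (hrelC lm).refl h, hi, hφ⟩⟩

theorem lrInv_alloc {h : Heap} (hi : lrInv lm h) {t : FullGround} {x : t.toType}
    (h1 : forallRefs (fun _ r => h.Contains r) t x)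
    (h2 : forallRefs (fun _ r => IsShareable lm r h) t x) {m : ℕ+ → Label}
    (hm : Heap.Maps (k := .gen _ labelMapPreord) (h.alloc (.ground t) x) lm m)
    (hc : (h.alloc (.ground t) x).Contains lm) (h' : Heap)
    (hh' : h' = Heap.write (k := .gen _ labelMapPreord) (h.alloc (.ground t) x) lm hc
      (Function.update m h.next .shareable)) :
    lrInv lm h' ∧ (hrelC lm).rel h h' ∧ h'.Contains (⟨h.next⟩ : MRef (.ground t)) ∧
      IsShareable lm (⟨h.next⟩ : MRef (.ground t)) h' := by
  obtain ⟨i1, i2, ⟨m', hm'⟩, i4, i5⟩ := hi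
  have hlt := hm'.lt
  have hmm : m = m' :=
    Heap.Maps.unique (k := .gen _ labelMapPreord)
      ((Heap.maps_alloc_ne (k := .ground t) x (ne_of_lt hlt) _).1 hm) hm'
  subst hmm
  have hlab : ∀ l n, HasLabel lm l n h ↔ m n = l := fun l n =>
    ⟨fun ⟨m2, a, b⟩ => by rw [hm'.unique a]; exact b, fun a => ⟨m, hm', a⟩⟩
  have hm2 : Heap.Maps (k := .gen _ labelMapPreord) h' lm (Function.update m h.next .shareable) := by
    rw [hh']
    exact Heap.maps_write_eq _ _
  have hlab2 : ∀ l n, HasLabel lm l n h' ↔ Function.update m h.next .shareable n = l := fun l n =>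
    ⟨fun ⟨m2, a, b⟩ => by rw [hm2.unique a]; exact b, fun a => ⟨_, hm2, a⟩⟩
  have hpriv : m h.next = .priv := (hlab _ _).1 (i5 _ le_rfl)
  have hle : h.Le h' := by
    rw [hh']
    refine (Heap.le_alloc h (k := .ground t) x).trans (Heap.le_write _ _ ?_)
    intro m0 hm0 n
    have : m0 = m := hm0.unique hm
    subst this
    by_cases hn : n = h.next
    · subst hn
      exact Or.inl hpriv
    · exact Or.inr (Function.update_of_ne (f := m0) hn Label.shareable).symm
  have hne : ∀ {k' : Kind} {r' : MRef k'} {v' : k'.El}, r'.addr ≠ h.next → r'.addr ≠ lm.addr →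
      (h'.Maps r' v' ↔ h.Maps r' v') := by
    intro k' r' v' a b
    rw [hh']
    exact (Heap.maps_write_ne hc _ b v').trans (Heap.maps_alloc_ne (k := .ground t) x a v')
  have hnew : h'.Maps (⟨h.next⟩ : MRef (.ground t)) x := by
    rw [hh']
    exact (Heap.maps_write_ne (k' := .ground t) (r' := ⟨h.next⟩) hc _ (ne_of_gt hlt) x).2
      (Heap.maps_alloc_eq (k := .ground t) h x)
  have hnext : h'.next = h.next + 1 := by rw [hh']; rfl
  have hsh : ∀ n, HasLabel lm .shareable n h → HasLabel lm .shareable n h' :=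
    fun n hn => hn.stable (by simp) hle
  have hold : ∀ {t' : FullGround} {r' : MRef (.ground t')} {v' : t'.toType}, r'.addr ≠ h.next →
      Heap.Maps (k := .ground t') h' r' v' → Heap.Maps (k := .ground t') h r' v' := by
    intro t' r' v' a hv'
    have hl : r'.addr ≠ lm.addr := by
      intro b
      have := Heap.kind_eq (k := .ground t') b hv' hm2
      cases this
    exact (hne a hl).1 hv'
  refine ⟨⟨?_, ?_, ⟨_, hm2⟩, ?_, ?_⟩, ⟨hle, ?_, ?_⟩, ⟨x, hnew⟩, ?_⟩
  · intro t' r' v' hv' _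
    refine forallRefs_mono (φ := fun _ r => h.Contains r) (fun _ _ hc => hle.contains hc) t' v' ?_
    by_cases ha : r'.addr = h.next
    · have := Heap.kind_eq (k := .ground t') (k' := .ground t) (r' := ⟨h.next⟩) ha hv' hnew
      cases this
      exact h1
    · have h0 := hold ha hv'
      exact i1 t' r' v' h0 ⟨_, h0⟩
  · intro t' r' v' hv' hs'
    refine forallRefs_mono (φ := fun _ r => IsShareable lm r h) (fun _ _ hc => hsh _ hc) t' v' ?_
    by_cases ha : r'.addr = h.next
    · have := Heap.kind_eq (k := .ground t') (k' := .ground t) (r' := ⟨h.next⟩) ha hv' hnew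
      cases this
      exact h2
    · have h0 := hold ha hv'
      refine i2 t' r' v' h0 ((hlab _ _).2 ?_)
      have := (hlab2 _ _).1 hs'
      rwa [Function.update_of_ne ha] at this
  · refine (hlab2 _ _).2 ?_
    rw [Function.update_of_ne (ne_of_lt hlt)]
    exact (hlab _ _).1 i4
  · intro n hn
    rw [hnext] at hn
    have hn' : h.next < n := lt_of_lt_of_le (PNat.lt_add_right h.next 1) hn
    refine (hlab2 _ _).2 ?_
    rw [Function.update_of_ne (ne_of_gt hn')]
    exact (hlab _ _).1 (i5 n hn'.le)
  · intro k r' v' hv' hl _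
    exact (hne (ne_of_lt hv'.lt) hl).2 hv'
  · intro k r' hr' l
    obtain ⟨v', hv'⟩ := hr'
    rw [hlab, hlab2, Function.update_of_ne (ne_of_lt hv'.lt)]
  · exact (hlab2 _ _).2 (Function.update_self _ _ _)

/-- `alloc` for the context: allocate, then label the new reference as shareable. -/
def ctxAlloc : PolyAlloc w (concrete w lm) := fun t x =>
  ⟨recallRefs lm t x (.alloc (.ground t) x fun r =>
      labelShareable lm r (witnessRef lm r (.ret r))), by
    intro p h hp
    obtain ⟨⟨hi, hx⟩, hpost⟩ := hp
    refine theta_recallRefs w lm p h t x _ hx fun c1 s1 => ?_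
    obtain ⟨m, hm⟩ := (Heap.le_alloc h (k := .ground t) x).contains hi.2.2.1
    have key := lrInv_alloc lm hi c1 s1 hm ⟨m, hm⟩ _ rfl
    refine ⟨m, hm, ⟨m, hm⟩, ?_, ?_⟩
    · intro m0 hm0 n
      have : m0 = m := hm0.unique hm
      subst this
      have hm' := (Heap.maps_alloc_ne (k := .ground t) x (ne_of_lt hi.2.2.1.choose_spec.lt) _).1 hm
      by_cases hn : n = h.next
      · subst hn
        obtain ⟨m2, a, b⟩ := hi.2.2.2.2 h.next le_rfl
        left
        rw [← b, hm'.unique a]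
      · exact Or.inr (Function.update_of_ne (f := m0) hn Label.shareable).symm
    · exact theta_witnessRef w lm _ _ p _ key.2.2.1 key.2.2.2 fun hφ =>
        hpost _ _ ⟨key.2.1.1, key.2.1, key.1, hφ⟩⟩


/-! ## Interfaces of unverified code -/

/-- Types whose values can be decomposed to check that every reference in them satisfies a predicate. -/
class EveryMRef (t : Type u) where
  every : MRefPred → t → Prop

/-- The error raised when a dynamic check fails. -/
inductive Err : Type
  | contractFailure

instance : EveryMRef Unit := ⟨fun _ _ => True⟩
instance : EveryMRef ℤ := ⟨fun _ _ => True⟩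
instance : EveryMRef Bool := ⟨fun _ _ => True⟩
instance : EveryMRef Err := ⟨fun _ _ => True⟩
instance {a : Type u} {b : Type v} [EveryMRef a] [EveryMRef b] : EveryMRef (a × b) :=
  ⟨fun φ x => EveryMRef.every φ x.1 ∧ EveryMRef.every φ x.2⟩
instance {a : Type u} {b : Type v} [EveryMRef a] [EveryMRef b] : EveryMRef (a ⊕ b) :=
  ⟨fun φ x => Sum.elim (EveryMRef.every φ) (EveryMRef.every φ) x⟩
instance {a : Type u} [EveryMRef a] : EveryMRef (Option a) := ⟨fun φ x => ∀ y ∈ x, EveryMRef.every φ y⟩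
instance {a : Type u} [EveryMRef a] : EveryMRef (List a) := ⟨fun φ x => ∀ y ∈ x, EveryMRef.every φ y⟩
instance {a : Type u} [EveryMRef a] : EveryMRef (ULift.{v} a) := ⟨fun φ x => EveryMRef.every φ x.down⟩
instance (t : FullGround) : EveryMRef (MRef (.ground t)) := ⟨fun φ r => φ (.ground t) r⟩
instance (t : FullGround) : EveryMRef (LList t.toType t) := ⟨fun φ x => forallRefs φ (.llist t) x⟩

/-- Types that may appear on the interface of unverified code. -/
class PolyIface (P : ThreeP) (t : Type u) where
  wt : EveryMRef t

/-- Functions on the interface of unverified code. -/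
def PolyArrow (P : ThreeP) (a : Type u) (b : Type v) [ca : PolyIface P a] [cb : PolyIface P b] :
    Type (max 1 u v) :=
  (x : a) → MST w b (fun h₀ => P.inv h₀ ∧ ca.wt.every P.phi x)
    (fun h₀ r h₁ => P.inv h₁ ∧ P.hrel.rel h₀ h₁ ∧ cb.wt.every P.phi r)

instance (P : ThreeP) : PolyIface P Unit := ⟨inferInstance⟩
instance (P : ThreeP) : PolyIface P ℤ := ⟨inferInstance⟩
instance (P : ThreeP) : PolyIface P Bool := ⟨inferInstance⟩
instance (P : ThreeP) : PolyIface P Err := ⟨inferInstance⟩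
instance (P : ThreeP) {a : Type u} {b : Type v} [ca : PolyIface P a] [cb : PolyIface P b] :
    PolyIface P (a × b) :=
  ⟨@instEveryMRefProd a b ca.wt cb.wt⟩
instance (P : ThreeP) {a : Type u} {b : Type v} [ca : PolyIface P a] [cb : PolyIface P b] :
    PolyIface P (a ⊕ b) :=
  ⟨@instEveryMRefSum a b ca.wt cb.wt⟩
instance (P : ThreeP) {a : Type u} [ca : PolyIface P a] : PolyIface P (Option a) :=
  ⟨@instEveryMRefOption a ca.wt⟩
instance (P : ThreeP) {a : Type u} [ca : PolyIface P a] : PolyIface P (List a) :=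
  ⟨@instEveryMRefList a ca.wt⟩
instance (P : ThreeP) {a : Type u} [ca : PolyIface P a] : PolyIface P (ULift.{v} a) :=
  ⟨@instEveryMRefULift a ca.wt⟩
instance (P : ThreeP) (t : FullGround) : PolyIface P (MRef (.ground t)) := ⟨inferInstance⟩
instance (P : ThreeP) (t : FullGround) : PolyIface P (LList t.toType t) := ⟨inferInstance⟩

/-- A function is not decomposed. -/
instance (P : ThreeP) {a : Type u} {b : Type v} [PolyIface P a] [PolyIface P b] :
    PolyIface P (PolyArrow w P a b) :=
  ⟨⟨fun _ _ => True⟩⟩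

/-! ## Higher-order contracts -/

/-- The pre- and post-condition of a function that can raise errors and that crosses the boundary:
it is exported to the unverified code, or imported from it. -/
inductive Spec (P : ThreeP) : Type (s + 1)
  | exported (a b : Type s) (ca : EveryMRef a) (cb : EveryMRef b) (pre : a → Heap → Prop)
      (post : a → Heap → b ⊕ Err → Heap → Prop)
  | imported (a b : Type s) (ca : EveryMRef a) (cb : EveryMRef b) (pre : a → Heap → Prop)
      (post : a → Heap → b ⊕ Err → Heap → Prop)

/-- The specifications in a type, as a tree: at a function type, its own specification, those in the
type of the argument, and those in the type of the result. -/
inductive SpecTree (P : ThreeP) : Type (s + 1)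
  | leaf
  | node (sp : Spec.{s} P) (l r : SpecTree P)

/-- The contract for a specification. For an exported function, a check that approximates its
pre-condition. For an imported function, a stateful contract: it runs before the call, and returns
the check that runs after the call and establishes the post-condition relative to the heap before
the call. Checks leave the heap unchanged. -/
def Hoc (P : ThreeP) : Spec.{s} P → Type (max 1 s)
  | .exported a _ ca _ pre _ =>
      (x : a) → MST w (Unit ⊕ Err) (fun h₀ => P.inv h₀ ∧ ca.every P.phi x)
        (fun h₀ r h₁ => h₀ = h₁ ∧ (r = .inl () → pre x h₀))
  | .imported a b _ cb pre post =>
      (x : a) → MST w (b ⊕ Err → MSTRepr (Unit ⊕ Err)) (pre x)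
        (fun eh check h₁ => eh = h₁ ∧ ∀ r : b ⊕ Err,
          (theta w (check r)).Le (prePostW
            (fun h₁ => P.inv h₁ ∧ P.hrel.rel eh h₁ ∧ (@instEveryMRefSum b Err cb inferInstance).every P.phi r)
            (fun h₁ rck h₁' => h₁ = h₁' ∧ (rck = .inl () → post x eh r h₁))))

/-- A tree of contracts, one for each specification in the tree of specifications. -/
inductive HocTree (P : ThreeP) : SpecTree.{s} P → Type (s + 1)
  | leaf : HocTree P .leaf
  | node {sp : Spec.{s} P} {l r : SpecTree.{s} P} (hoc : Hoc w P sp) (hl : HocTree P l)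
      (hr : HocTree P r) : HocTree P (.node sp l r)

/-- Source types that can be exported: mapped to an intermediate type. -/
structure ExportableFrom (P : ThreeP) (styp : Type u) (specs : SpecTree.{s} P) where
  c_styp : EveryMRef styp
  ityp : Type v
  c_ityp : PolyIface P ityp
  exporting : styp → HocTree w P specs → ityp
  export_preserves : ∀ (x : styp) (φ : MRefPred) (hocs : HocTree w P specs),
    c_styp.every φ x → c_ityp.wt.every φ (exporting x hocs)

/-- Source types into which importing from an intermediate type always succeeds. -/
structure SafeImportableTo (P : ThreeP) (styp : Type u) (specs : SpecTree.{s} P) where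
  c_styp : EveryMRef styp
  ityp : Type v
  c_ityp : PolyIface P ityp
  safeImport : ityp → HocTree w P specs → styp
  import_preserves : ∀ (x : ityp) (φ : MRefPred) (hocs : HocTree w P specs),
    c_ityp.wt.every φ x → c_styp.every φ (safeImport x hocs)

/-! ## Source and target languages, when the program has initial control -/

structure SrcInterface where
  ctype : ThreeP → Type u
  specs_of_ctype : (P : ThreeP) → SpecTree.{s} P
  hocs : HocTree w (concrete w lm) (specs_of_ctype (concrete w lm))
  imp_ctype : (P : ThreeP) → SafeImportableTo.{u, v, s} w P (ctype P) (specs_of_ctype P)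
  psi : Heap → ℤ → Heap → Prop

structure TgtInterface where
  ctype : ThreeP → Type v
  interm_ctype : (P : ThreeP) → PolyIface P (ctype P)

/-- The trivial pre- and post-condition. -/
def preTop : Heap → Prop := fun _ => True
def postTop : Heap → ℤ → Heap → Prop := fun _ _ _ => True

/-- Whole source programs: a post-condition and a computation that guarantees it. -/
def WholeS : Type 1 := (psi : Heap → ℤ → Heap → Prop) × (Unit → LR w lm ℤ preTop psi)
def WholeT : Type 1 := Unit → LR w lm ℤ preTop postTop

variable {w lm}

def CtxS (I : SrcInterface.{u, v, s} w lm) : Type u := I.ctype (concrete w lm)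

def ProgS (I : SrcInterface.{u, v, s} w lm) : Type (max 1 u) :=
  I.ctype (concrete w lm) → LR w lm ℤ preTop I.psi

def linkS {I : SrcInterface.{u, v, s} w lm} (P : ProgS I) (C : CtxS I) : WholeS w lm :=
  ⟨I.psi, fun _ => P C⟩

variable (w) in
/-- Target contexts: polymorphic in the three predicates and in the operations on references. -/
def CtxT (I : TgtInterface.{v}) : Type (max 1 v) :=
  (P : ThreeP) → PolyAlloc w P → PolyRead w P → PolyWrite w P → I.ctype P

variable (w lm) in
def ProgT (I : TgtInterface.{v}) : Type (max 1 v) :=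
  I.ctype (concrete w lm) → LR w lm ℤ preTop postTop

/-- A target context, at the concrete predicates and operations. -/
def instCtx {I : TgtInterface.{v}} (C : CtxT w I) : I.ctype (concrete w lm) :=
  C (concrete w lm) (ctxAlloc w lm) (ctxRead w lm) (ctxWrite w lm)

def linkT {I : TgtInterface.{v}} (P : ProgT w lm I) (C : CtxT w I) : WholeT w lm :=
  fun _ => P (instCtx C)

def compileInterface (I : SrcInterface.{u, v, s} w lm) : TgtInterface.{v} where
  ctype P := (I.imp_ctype P).ityp
  interm_ctype P := (I.imp_ctype P).c_ityp

/-- Forget a post-condition. -/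
def LR.toTop {pre : Heap → Prop} {post : Heap → ℤ → Heap → Prop} (m : LR w lm ℤ pre post) :
    LR w lm ℤ pre postTop :=
  m.weaken (fun _ h => h) (fun _ _ _ _ h => ⟨h.1, trivial⟩)

/-- Compilation wraps the program with the contracts. -/
def compileProg {I : SrcInterface.{u, v, s} w lm} (P : ProgS I) : ProgT w lm (compileInterface I) :=
  fun C => (P ((I.imp_ctype (concrete w lm)).safeImport C I.hocs)).toTop

def backTranslateCtx {I : SrcInterface.{u, v, s} w lm} (C : CtxT w (compileInterface I)) : CtxS I :=
  (I.imp_ctype (concrete w lm)).safeImport (instCtx C) I.hocs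

/-! ## Behaviours -/

/-- Relations between the initial heap, the result and the final heap. -/
def StateSem : Type 1 := Heap → ℤ → Heap → Prop

variable (w) in
def behMST (m : MSTRepr ℤ) : StateSem := fun h₀ r h₁ => ∀ p, (theta w m).wp p h₀ → p r h₁

/-- The behaviour of a whole program. -/
def beh {psi : Heap → ℤ → Heap → Prop} (W : Unit → LR w lm ℤ preTop psi) : StateSem :=
  behMST w (W ()).1

def behS (W : WholeS w lm) : StateSem := beh W.2
def behT (W : WholeT w lm) : StateSem := beh W

/-! ## Source and target languages, when the context has initial control -/

variable (w lm) in
structure SrcInterfaceDual where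
  ptype : ThreeP → Type u
  specs_of_ptype : (P : ThreeP) → SpecTree.{s} P
  hocs : HocTree w (concrete w lm) (specs_of_ptype (concrete w lm))
  exp_ptype : (P : ThreeP) → ExportableFrom.{u, v, s} w P (ptype P) (specs_of_ptype P)

structure TgtInterfaceDual where
  ptype : ThreeP → Type v
  interm_ptype : (P : ThreeP) → PolyIface P (ptype P)

/-- The guarantee of contexts: they evolve the heap along the concrete preorder. -/
def psiDual (lm : LabelMapRef) : Heap → ℤ → Heap → Prop := fun h₀ _ h₁ => (hrelC lm).rel h₀ h₁

/-- Programs are values all of whose references can be shared (no constraint on function types). -/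
def ProgSDual (I : SrcInterfaceDual.{u, v, s} w lm) : Type u :=
  {x : I.ptype (concrete w lm) // (I.exp_ptype (concrete w lm)).c_styp.every (phiC w lm) x}

def CtxSDual (I : SrcInterfaceDual.{u, v, s} w lm) : Type (max 1 u) :=
  (x : I.ptype (concrete w lm)) →
    LR w lm ℤ (fun _ => (I.exp_ptype (concrete w lm)).c_styp.every (phiC w lm) x) (psiDual lm)

def linkSDual {I : SrcInterfaceDual.{u, v, s} w lm} (P : ProgSDual I) (C : CtxSDual I) : WholeS w lm :=
  ⟨psiDual lm, fun _ => (C P.1).weaken (fun _ h => ⟨h.1, P.2⟩) (fun _ _ _ _ h => h)⟩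

variable (w) in
def CtxTDual (I : TgtInterfaceDual.{v}) : Type (max 1 v) :=
  (P : ThreeP) → PolyAlloc w P → PolyRead w P → PolyWrite w P →
    @PolyArrow w P (I.ptype P) ℤ (I.interm_ptype P) inferInstance

variable (w lm) in
def ProgTDual (I : TgtInterfaceDual.{v}) : Type v :=
  {x : I.ptype (concrete w lm) // (I.interm_ptype (concrete w lm)).wt.every (phiC w lm) x}

def instCtxDual {I : TgtInterfaceDual.{v}} (C : CtxTDual w I) :
    @PolyArrow w (concrete w lm) (I.ptype (concrete w lm)) ℤ (I.interm_ptype (concrete w lm))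
      inferInstance :=
  C (concrete w lm) (ctxAlloc w lm) (ctxRead w lm) (ctxWrite w lm)

def linkTDual {I : TgtInterfaceDual.{v}} (P : ProgTDual w lm I) (C : CtxTDual w I) : WholeT w lm :=
  fun _ => (instCtxDual C P.1).weaken (fun _ h => ⟨h.1, P.2⟩) (fun _ _ _ _ h => ⟨h.1, trivial⟩)

def compileInterfaceDual (I : SrcInterfaceDual.{u, v, s} w lm) : TgtInterfaceDual.{v} where
  ptype P := (I.exp_ptype P).ityp
  interm_ptype P := (I.exp_ptype P).c_ityp

def compileProgDual {I : SrcInterfaceDual.{u, v, s} w lm} (P : ProgSDual I) :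
    ProgTDual w lm (compileInterfaceDual I) :=
  ⟨(I.exp_ptype (concrete w lm)).exporting P.1 I.hocs,
    (I.exp_ptype (concrete w lm)).export_preserves _ _ _ P.2⟩

def backTranslateCtxDual {I : SrcInterfaceDual.{u, v, s} w lm}
    (C : CtxTDual w (compileInterfaceDual I)) : CtxSDual I := fun x =>
  (instCtxDual C ((I.exp_ptype (concrete w lm)).exporting x I.hocs)).weaken
    (fun _ h => ⟨h.1, (I.exp_ptype (concrete w lm)).export_preserves _ _ _ h.2⟩)
    (fun _ _ _ _ h => ⟨h.1, h.2.1⟩)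


/-! ## Syntactic contexts: a total simply typed language with first-order ML-style references -/

/-- Types. References and linked lists store full ground types only. -/
inductive Ty : Type
  | unit | int | bool
  | sum (a b : Ty)
  | pair (a b : Ty)
  | ref (t : FullGround)
  | llist (t : FullGround)
  | arrow (a b : Ty)

def Ty.ofGround : FullGround → Ty
  | .unit => .unit
  | .int => .int
  | .bool => .bool
  | .sum a b => .sum (ofGround a) (ofGround b)
  | .pair a b => .pair (ofGround a) (ofGround b)
  | .ref a => .ref a
  | .llist a => .llist a

/-- Expressions, with de Bruijn indices. -/
inductive Exp : Type
  | var (n : ℕ)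
  | unit | tru | fls
  | lit (n : ℤ)
  | nil
  | lam (e : Exp)
  | app (f e : Exp)
  | ite (c a b : Exp)
  | add (a b : Exp)
  | neg (a : Exp)
  | le (a b : Exp)
  | iter (n f x : Exp)
  | inl (e : Exp)
  | inr (e : Exp)
  | case (e l r : Exp)
  | mk (a b : Exp)
  | fst (e : Exp)
  | snd (e : Exp)
  | cons (a b : Exp)
  | listCase (e n c : Exp)
  | alloc (e : Exp)
  | read (e : Exp)
  | write (r e : Exp)

/-- Typing derivations. `iter n f x` applies `f` to `x` as many times as `n` says (not at all if it
is negative); the second branch of `listCase` binds the head (index 0) and the tail (index 1). -/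
inductive Typing : List Ty → Exp → Ty → Type
  | var {G : List Ty} {n : ℕ} {a : Ty} (h : G[n]? = some a) : Typing G (.var n) a
  | unit {G : List Ty} : Typing G .unit .unit
  | tru {G : List Ty} : Typing G .tru .bool
  | fls {G : List Ty} : Typing G .fls .bool
  | lit {G : List Ty} (n : ℤ) : Typing G (.lit n) .int
  | nil {G : List Ty} (t : FullGround) : Typing G .nil (.llist t)
  | lam {G : List Ty} {e : Exp} {a b : Ty} (d : Typing (a :: G) e b) : Typing G (.lam e) (.arrow a b)
  | app {G : List Ty} {f e : Exp} {a b : Ty} (df : Typing G f (.arrow a b)) (d : Typing G e a) :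
      Typing G (.app f e) b
  | ite {G : List Ty} {c x y : Exp} {a : Ty} (dc : Typing G c .bool) (dx : Typing G x a)
      (dy : Typing G y a) : Typing G (.ite c x y) a
  | add {G : List Ty} {x y : Exp} (dx : Typing G x .int) (dy : Typing G y .int) :
      Typing G (.add x y) .int
  | neg {G : List Ty} {x : Exp} (dx : Typing G x .int) : Typing G (.neg x) .int
  | le {G : List Ty} {x y : Exp} (dx : Typing G x .int) (dy : Typing G y .int) :
      Typing G (.le x y) .bool
  | iter {G : List Ty} {n f x : Exp} {a : Ty} (dn : Typing G n .int) (df : Typing G f (.arrow a a))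
      (dx : Typing G x a) : Typing G (.iter n f x) a
  | inl {G : List Ty} {e : Exp} {a : Ty} (b : Ty) (d : Typing G e a) : Typing G (.inl e) (.sum a b)
  | inr {G : List Ty} {e : Exp} (a : Ty) {b : Ty} (d : Typing G e b) : Typing G (.inr e) (.sum a b)
  | case {G : List Ty} {e l r : Exp} {a b c : Ty} (d : Typing G e (.sum a b))
      (dl : Typing (a :: G) l c) (dr : Typing (b :: G) r c) : Typing G (.case e l r) c
  | mk {G : List Ty} {x y : Exp} {a b : Ty} (dx : Typing G x a) (dy : Typing G y b) :
      Typing G (.mk x y) (.pair a b)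
  | fst {G : List Ty} {e : Exp} {a b : Ty} (d : Typing G e (.pair a b)) : Typing G (.fst e) a
  | snd {G : List Ty} {e : Exp} {a b : Ty} (d : Typing G e (.pair a b)) : Typing G (.snd e) b
  | cons {G : List Ty} {x y : Exp} {t : FullGround} (dx : Typing G x (Ty.ofGround t))
      (dy : Typing G y (.ref (.llist t))) : Typing G (.cons x y) (.llist t)
  | listCase {G : List Ty} {e n c : Exp} {t : FullGround} {a : Ty} (d : Typing G e (.llist t))
      (dn : Typing G n a) (dc : Typing (Ty.ofGround t :: .ref (.llist t) :: G) c a) :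
      Typing G (.listCase e n c) a
  | alloc {G : List Ty} {e : Exp} {t : FullGround} (d : Typing G e (Ty.ofGround t)) :
      Typing G (.alloc e) (.ref t)
  | read {G : List Ty} {e : Exp} {t : FullGround} (d : Typing G e (.ref t)) :
      Typing G (.read e) (Ty.ofGround t)
  | write {G : List Ty} {r e : Exp} {t : FullGround} (dr : Typing G r (.ref t))
      (d : Typing G e (Ty.ofGround t)) : Typing G (.write r e) .unit

/-- Syntactic values. -/
def Exp.IsVal : Exp → Prop
  | .unit | .tru | .fls | .lit _ | .nil | .lam _ => True
  | .inl e | .inr e => e.IsVal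
  | .mk a b => a.IsVal ∧ b.IsVal
  | _ => False

variable (w) in
/-- The type of the representation that a syntactic type stands for. -/
def Ty.sem (P : ThreeP) : Ty → (a : Type 1) × PolyIface P a
  | .unit => ⟨ULift Unit, inferInstance⟩
  | .int => ⟨ULift ℤ, inferInstance⟩
  | .bool => ⟨ULift Bool, inferInstance⟩
  | .sum a b =>
      letI := (a.sem P).2
      letI := (b.sem P).2
      ⟨(a.sem P).1 ⊕ (b.sem P).1, inferInstance⟩
  | .pair a b =>
      letI := (a.sem P).2
      letI := (b.sem P).2
      ⟨(a.sem P).1 × (b.sem P).1, inferInstance⟩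
  | .ref t => ⟨ULift (MRef (.ground t)), inferInstance⟩
  | .llist t => ⟨ULift (LList t.toType t), inferInstance⟩
  | .arrow a b =>
      letI := (a.sem P).2
      letI := (b.sem P).2
      ⟨PolyArrow w P (a.sem P).1 (b.sem P).1, inferInstance⟩

variable {P : ThreeP}

variable (w) in
def Ty.Every (P : ThreeP) (a : Ty) (x : (a.sem w P).1) : Prop := (a.sem w P).2.wt.every P.phi x

variable (w) in
/-- Semantic values: all their references satisfy the abstract predicate. -/
def Val (P : ThreeP) (a : Ty) : Type 1 := {x : (a.sem w P).1 // a.Every w P x}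

variable (w) in
/-- Semantic computations. -/
def Comp (P : ThreeP) (a : Ty) : Type 1 :=
  MST w (a.sem w P).1 P.inv (fun h₀ r h₁ => P.inv h₁ ∧ P.hrel.rel h₀ h₁ ∧ a.Every w P r)

variable (w) in
def Env (P : ThreeP) : List Ty → Type 1
  | [] => PUnit
  | a :: G => Val w P a × Env P G

def Env.lookup : (G : List Ty) → (n : ℕ) → {a : Ty} → G[n]? = some a → Env w P G → Val w P a
  | [], _, _, h, _ => absurd h (by simp)
  | _ :: _, 0, _, h, g => Option.some.inj h ▸ g.1
  | _ :: G, n + 1, _, h, g => Env.lookup G n (by simpa using h) g.2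

def toGround : (t : FullGround) → ((Ty.ofGround t).sem w P).1 → t.toType
  | .unit, _ => ()
  | .int, x => x.down
  | .bool, x => x.down
  | .sum a _, .inl x => .inl (toGround a x)
  | .sum _ b, .inr x => .inr (toGround b x)
  | .pair a b, (x, y) => (toGround a x, toGround b y)
  | .ref _, x => x.down
  | .llist _, x => x.down

def fromGround : (t : FullGround) → t.toType → ((Ty.ofGround t).sem w P).1
  | .unit, _ => ⟨()⟩
  | .int, x => ⟨x⟩
  | .bool, x => ⟨x⟩
  | .sum a _, .inl x => .inl (fromGround a x)
  | .sum _ b, .inr x => .inr (fromGround b x)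
  | .pair a b, (x, y) => (fromGround a x, fromGround b y)
  | .ref _, x => ⟨x⟩
  | .llist _, x => ⟨x⟩

theorem every_toGround : (t : FullGround) → (x : ((Ty.ofGround t).sem w P).1) →
    (Ty.ofGround t).Every w P x → forallRefs P.phi t (toGround t x)
  | .unit, _, _ => trivial
  | .int, _, _ => trivial
  | .bool, _, _ => trivial
  | .sum a _, .inl x, h => every_toGround a x h
  | .sum _ b, .inr x, h => every_toGround b x h
  | .pair a b, (x, y), h => ⟨every_toGround a x h.1, every_toGround b y h.2⟩
  | .ref _, _, h => h
  | .llist _, _, h => h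

theorem every_fromGround : (t : FullGround) → (x : t.toType) → forallRefs P.phi t x →
    (Ty.ofGround t).Every w P (fromGround t x)
  | .unit, _, _ => trivial
  | .int, _, _ => trivial
  | .bool, _, _ => trivial
  | .sum a _, .inl x, h => every_fromGround a x h
  | .sum _ b, .inr x, h => every_fromGround b x h
  | .pair a b, (x, y), h => ⟨every_fromGround a x h.1, every_fromGround b y h.2⟩
  | .ref _, _, h => h
  | .llist _, _, h => h

def Comp.pure {a : Ty} (x : Val w P a) : Comp w P a :=
  ⟨.ret x.1, fun _ h hp => hp.2 _ h ⟨Heap.Le.refl h, hp.1, P.hrel.refl h, x.2⟩⟩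

/-- Sequencing of a step with any result type whose result is known to satisfy `Q`. -/
def Comp.after {α : Type u} {b : Ty} {pre : Heap → Prop} {Q : α → Prop}
    (m : MST w α pre (fun h₀ r h₁ => P.hrel.rel h₀ h₁ ∧ P.inv h₁ ∧ Q r)) (hpre : ∀ h, P.inv h → pre h)
    (f : (x : α) → Q x → Comp w P b) : Comp w P b :=
  ⟨m.1.bind fun x => .require (Q x) fun hx => (f x hx).1, by
    intro p h hp
    refine (theta_bind w _ _ p h).2 (m.2 _ h ⟨hpre h hp.1, ?_⟩)
    rintro v h₁ ⟨hle, hrel, hinv, hQ⟩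
    refine ⟨hQ, (f v hQ).2 p h₁ ⟨hinv, ?_⟩⟩
    rintro v' h₂ ⟨hle', hinv', hrel', hQ'⟩
    exact hp.2 v' h₂ ⟨hle.trans hle', hinv', P.hrel.trans _ _ _ hrel hrel', hQ'⟩⟩

def Comp.bind {a b : Ty} (m : Comp w P a) (f : Val w P a → Comp w P b) : Comp w P b :=
  Comp.after (Q := a.Every w P) (m.weaken (fun _ h => h) (fun _ _ _ _ h => ⟨h.2.1, h.1, h.2.2⟩))
    (fun _ h => h) fun x hx => f ⟨x, hx⟩

def Comp.lam {a b : Ty} (f : Val w P a → Comp w P b) : Val w P (.arrow a b) :=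
  ⟨fun (x : (a.sem w P).1) =>
    (⟨.require (a.Every w P x) fun hx => (f ⟨x, hx⟩).1,
      fun p h hp => ⟨hp.1.2, (f ⟨x, hp.1.2⟩).2 p h ⟨hp.1.1, hp.2⟩⟩⟩ :
      MST w (b.sem w P).1 (fun h₀ => P.inv h₀ ∧ a.Every w P x)
        (fun h₀ r h₁ => P.inv h₁ ∧ P.hrel.rel h₀ h₁ ∧ b.Every w P r)), trivial⟩

def Comp.app {a b : Ty} (f : Val w P (.arrow a b)) (x : Val w P a) : Comp w P b :=
  ⟨(f.1 x.1).1, fun p h hp => (f.1 x.1).2 p h ⟨⟨hp.1, x.2⟩, hp.2⟩⟩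

def Comp.iter {a : Ty} (f : Val w P (.arrow a a)) : ℕ → Val w P a → Comp w P a
  | 0, x => Comp.pure x
  | n + 1, x => (Comp.app f x).bind fun y => Comp.iter f n y

/-- The translation of typed expressions: recursion on the typing derivation. -/
def denote (al : PolyAlloc w P) (rd : PolyRead w P) (wr : PolyWrite w P) :
    {G : List Ty} → {e : Exp} → {a : Ty} → Typing G e a → Env w P G → Comp w P a
  | _, _, _, .var h, g => Comp.pure (Env.lookup _ _ h g)
  | _, _, _, .unit, _ => Comp.pure ⟨⟨()⟩, trivial⟩
  | _, _, _, .tru, _ => Comp.pure ⟨⟨true⟩, trivial⟩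
  | _, _, _, .fls, _ => Comp.pure ⟨⟨false⟩, trivial⟩
  | _, _, _, .lit n, _ => Comp.pure ⟨⟨n⟩, trivial⟩
  | _, _, _, .nil _, _ => Comp.pure ⟨⟨.nil⟩, trivial⟩
  | _, _, _, .lam d, g => Comp.pure (Comp.lam fun x => denote al rd wr d (x, g))
  | _, _, _, .app df d, g =>
      (denote al rd wr df g).bind fun f => (denote al rd wr d g).bind fun x => Comp.app f x
  | _, _, _, .ite dc dx dy, g =>
      (denote al rd wr dc g).bind fun c =>
        match (c.1 : ULift Bool).down with
        | true => denote al rd wr dx g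
        | false => denote al rd wr dy g
  | _, _, _, .add dx dy, g =>
      (denote al rd wr dx g).bind fun x => (denote al rd wr dy g).bind fun y =>
        Comp.pure ⟨⟨(x.1 : ULift ℤ).down + (y.1 : ULift ℤ).down⟩, trivial⟩
  | _, _, _, .neg dx, g =>
      (denote al rd wr dx g).bind fun x => Comp.pure ⟨⟨- (x.1 : ULift ℤ).down⟩, trivial⟩
  | _, _, _, .le dx dy, g =>
      (denote al rd wr dx g).bind fun x => (denote al rd wr dy g).bind fun y =>
        Comp.pure ⟨⟨decide ((x.1 : ULift ℤ).down ≤ (y.1 : ULift ℤ).down)⟩, trivial⟩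
  | _, _, _, .iter dn df dx, g =>
      (denote al rd wr dn g).bind fun n => (denote al rd wr df g).bind fun f =>
        (denote al rd wr dx g).bind fun x => Comp.iter f (n.1 : ULift ℤ).down.toNat x
  | _, _, _, .inl _ d, g => (denote al rd wr d g).bind fun x => Comp.pure ⟨.inl x.1, x.2⟩
  | _, _, _, .inr _ d, g => (denote al rd wr d g).bind fun x => Comp.pure ⟨.inr x.1, x.2⟩
  | _, _, _, .case d dl dr, g =>
      (denote al rd wr d g).bind fun x =>
        match x with
        | ⟨.inl y, hy⟩ => denote al rd wr dl (⟨y, hy⟩, g)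
        | ⟨.inr y, hy⟩ => denote al rd wr dr (⟨y, hy⟩, g)
  | _, _, _, .mk dx dy, g =>
      (denote al rd wr dx g).bind fun x => (denote al rd wr dy g).bind fun y =>
        Comp.pure ⟨(x.1, y.1), x.2, y.2⟩
  | _, _, _, .fst d, g => (denote al rd wr d g).bind fun x => Comp.pure ⟨x.1.1, x.2.1⟩
  | _, _, _, .snd d, g => (denote al rd wr d g).bind fun x => Comp.pure ⟨x.1.2, x.2.2⟩
  | _, _, _, .cons (t := t) dx dy, g =>
      (denote al rd wr dx g).bind fun x => (denote al rd wr dy g).bind fun y =>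
        Comp.pure ⟨⟨.cons (toGround t x.1) (y.1 : ULift (MRef (.ground (.llist t)))).down⟩,
          every_toGround t x.1 x.2, y.2⟩
  | _, _, _, .listCase (t := t) d dn dc, g =>
      (denote al rd wr d g).bind fun x =>
        match x with
        | ⟨⟨.nil⟩, _⟩ => denote al rd wr dn g
        | ⟨⟨.cons y tl⟩, h⟩ =>
            denote al rd wr dc (⟨fromGround t y, every_fromGround t y h.1⟩, ⟨⟨tl⟩, h.2⟩, g)
  | _, _, _, .alloc (t := t) d, g =>
      (denote al rd wr d g).bind fun x =>
        Comp.after (Q := fun r => P.phi (.ground t) r) (al t (toGround t x.1))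
          (fun _ h => ⟨h, every_toGround t x.1 x.2⟩) fun r hr => Comp.pure ⟨⟨r⟩, hr⟩
  | _, _, _, .read (t := t) d, g =>
      (denote al rd wr d g).bind fun x =>
        Comp.after (Q := fun v => forallRefs P.phi t v)
          (rd t (x.1 : ULift (MRef (.ground t))).down) (fun _ h => ⟨h, x.2⟩)
          fun v hv => Comp.pure ⟨fromGround t v, every_fromGround t v hv⟩
  | _, _, _, .write (t := t) dr d, g =>
      (denote al rd wr dr g).bind fun x => (denote al rd wr d g).bind fun y =>
        Comp.after (Q := fun _ => True)
          ((wr t (x.1 : ULift (MRef (.ground t))).down (toGround t y.1)).weaken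
            (fun _ h => h) (fun _ _ _ _ h => ⟨h.1, h.2, trivial⟩))
          (fun _ h => ⟨h, x.2, every_toGround t y.1 y.2⟩) fun _ _ => Comp.pure ⟨⟨()⟩, trivial⟩

/-- The translation of typed values, which yields a value instead of a computation. -/
def denoteVal (al : PolyAlloc w P) (rd : PolyRead w P) (wr : PolyWrite w P) :
    {G : List Ty} → {e : Exp} → {a : Ty} → Typing G e a → e.IsVal → Env w P G → Val w P a
  | _, _, _, .unit, _, _ => ⟨⟨()⟩, trivial⟩
  | _, _, _, .tru, _, _ => ⟨⟨true⟩, trivial⟩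
  | _, _, _, .fls, _, _ => ⟨⟨false⟩, trivial⟩
  | _, _, _, .lit n, _, _ => ⟨⟨n⟩, trivial⟩
  | _, _, _, .nil _, _, _ => ⟨⟨.nil⟩, trivial⟩
  | _, _, _, .lam d, _, g => Comp.lam fun x => denote al rd wr d (x, g)
  | _, _, _, .inl _ d, h, g => ⟨.inl (denoteVal al rd wr d h g).1, (denoteVal al rd wr d h g).2⟩
  | _, _, _, .inr _ d, h, g => ⟨.inr (denoteVal al rd wr d h g).1, (denoteVal al rd wr d h g).2⟩
  | _, _, _, .mk dx dy, h, g =>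
      ⟨((denoteVal al rd wr dx h.1 g).1, (denoteVal al rd wr dy h.2 g).1),
        (denoteVal al rd wr dx h.1 g).2, (denoteVal al rd wr dy h.2 g).2⟩

variable (w) in
/-- Target interfaces given by a syntactic type. -/
structure SynTgtInterface extends TgtInterface.{1} where
  typ : Ty
  sem_eq : ∀ P : ThreeP, typ.sem w P = ⟨ctype P, interm_ctype P⟩

/-- Syntactic target contexts: closed values with a typing derivation. -/
structure SynCtxT (I : SynTgtInterface w) where
  exp : Exp
  isVal : exp.IsVal
  typing : Typing [] exp I.typ

/-- From syntactic contexts to contexts. -/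
def SynCtxT.translate {I : SynTgtInterface w} (C : SynCtxT I) : CtxT w I.toTgtInterface :=
  fun P al rd wr =>
    cast (congrArg Sigma.fst (I.sem_eq P)) (denoteVal al rd wr C.typing C.isVal PUnit.unit).1

def linkSynT {I : SynTgtInterface w} (P : ProgT w lm I.toTgtInterface) (C : SynCtxT I) : WholeT w lm :=
  linkT P C.translate

variable (w lm) in
/-- Source interfaces whose compiled interface is given by a syntactic type. -/
structure SynSrcInterface extends SrcInterface.{u, 1, s} w lm where
  typ : Ty
  sem_eq : ∀ P : ThreeP, typ.sem w P = ⟨(imp_ctype P).ityp, (imp_ctype P).c_ityp⟩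

def compileSynInterface (I : SynSrcInterface.{u, s} w lm) : SynTgtInterface w where
  toTgtInterface := compileInterface I.toSrcInterface
  typ := I.typ
  sem_eq := I.sem_eq

def backTranslateSynCtx {I : SynSrcInterface.{u, s} w lm} (C : SynCtxT (compileSynInterface I)) :
    CtxS I.toSrcInterface :=
  backTranslateCtx (I := I.toSrcInterface) C.translate

end SecRef

/-!
Linking, compilation and back-translation are arranged so that the source whole program and the
target whole program run the same computation: compilation puts the import (or export) with its
contracts around the program, back-translation puts it around the instantiated context, and linking
composes the two. The only remaining difference is the specification that indexes the computation.
Weakening replaces the proof that a computation satisfies its specification and keeps the underlying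
element of the free monad, and a behaviour depends on that element alone. So with `C↑` as the source
context the two behaviours are definitionally equal. For syntactic contexts, linking and
back-translation both start with `SynCtxT.translate`, so that the argument for semantic contexts
applies to the translated one.
-/

theorem theorem4 (w : SecRef.Tokens) (lm : SecRef.LabelMapRef) :
    -- the program has initial control
    (∀ (I : SecRef.SrcInterface.{u, v, s} w lm) (CT : SecRef.CtxT w (SecRef.compileInterface I)),
      ∃ CS : SecRef.CtxS I, CS = SecRef.backTranslateCtx CT ∧
        ∀ P : SecRef.ProgS I,
          SecRef.behT (SecRef.linkT (SecRef.compileProg P) CT) = SecRef.behS (SecRef.linkS P CS)) ∧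
    -- the context has initial control
    (∀ (I : SecRef.SrcInterfaceDual.{u, v, s} w lm)
      (CT : SecRef.CtxTDual w (SecRef.compileInterfaceDual I)),
      ∃ CS : SecRef.CtxSDual I, CS = SecRef.backTranslateCtxDual CT ∧
        ∀ P : SecRef.ProgSDual I,
          SecRef.behT (SecRef.linkTDual (SecRef.compileProgDual P) CT) =
            SecRef.behS (SecRef.linkSDual P CS)) ∧
    -- target contexts are typed syntactic values
    (∀ (I : SecRef.SynSrcInterface.{u, s} w lm)
      (CT : SecRef.SynCtxT (SecRef.compileSynInterface I)),
      ∃ CS : SecRef.CtxS I.toSrcInterface, CS = SecRef.backTranslateSynCtx CT ∧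
        ∀ P : SecRef.ProgS I.toSrcInterface,
          SecRef.behT (SecRef.linkSynT (I := SecRef.compileSynInterface I)
            (SecRef.compileProg P) CT) = SecRef.behS (SecRef.linkS P CS)) := by
  refine ⟨fun I CT => ⟨SecRef.backTranslateCtx CT, rfl, fun P => ?_⟩,
    fun I CT => ⟨SecRef.backTranslateCtxDual CT, rfl, fun P => ?_⟩,
    fun I CT => ⟨SecRef.backTranslateSynCtx CT, rfl, fun P => ?_⟩⟩
  -- both sides are `behMST w` of the program applied to the imported context
  · rfl
  -- both sides are `behMST w` of the context applied to the exported program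
  · rfl
  · rfl
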